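/- Let $X$ be a real Banach space with topological dual $X^*$. Assume that $X$ is weakly compactly generated (WCG), i.e. there is a weakly compact set $A\subseteq X$ whose linear span is norm-dense in $X$. Let $f\colon X\to\mathbb{R}\cup\{\infty\}$ be a proper (that is, not identically $\infty$) lower semicontinuous convex function. For a normed space $Z$, let $\mathcal{S}(Z)$ denote the family of all closed separable linear subspaces of $Z$. A subfamily $\mathcal{R}\subseteq\mathcal{S}(Z)$ is called \emph{rich} if (i) for every $S\in\mathcal{S}(Z)$ there is $W\in\mathcal{R}$ with $S\subseteq W$, and (ii) for every increasing sequence $W_1\subseteq W_2\subseteq\cdots$ of members of $\mathcal{R}$, $\overline{\bigcup_{n} W_n}\in\mathcal{R}$. For a normed space $E$ and a function $g\colon E\to\mathbb{R}\cup\{\infty\}$, let $g^*(e^*)=\sup_{e\in E}\{\langle e^*,e\rangle-g(e)\}$, $e^*\in E^*$, be its Fenchel conjugate. Then there exists a family $\mathcal{R}$ of rectangles $V\times Y$, with $V\in\mathcal{S}(X)$ and $Y\in\mathcal{S}(X^*)$, which is rich in $\mathcal{S}(X\times X^*)$ and such that, for every $V\times Y\in\mathcal{R}$, $$(f|_V)^*(x^*|_V)=f^*(x^*)\qquad\text{for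 all } x^*\in\overline{Y}^{w^*},$$ where $\overline{Y}^{w^*}$ is the closure of $Y$ in the weak$^*$ topology of $X^*$, and the conjugate of $f|_V$ is taken on the normed space $V$. -/

import Mathlib

/-- A real normed space is weakly compactly generated if some weakly compact subset has a
norm-dense linear span. -/
def IsWCG (X : Type*) [NormedAddCommGroup X] [NormedSpace ℝ X] : Prop :=
  ∃ A : Set X, IsCompact (toWeakSpace ℝ X '' A) ∧ Dense (Submodule.span ℝ A : Set X)

/-- The epigraph of an extended real valued function. -/
def epigraph {X : Type*} (f : X → EReal) : Set (X × ℝ) :=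
  {p | f p.1 ≤ (p.2 : EReal)}

/-- The effective domain of an extended real valued function. -/
def effDomain {X : Type*} (f : X → EReal) : Set X :=
  {x | f x < ⊤}

/-- A proper lower semicontinuous convex function `X → ℝ ∪ {∞}`, where `ℝ ∪ {∞}` is
the set of extended reals different from `-∞`. -/
structure IsProperLscConvex {X : Type*} [NormedAddCommGroup X] [NormedSpace ℝ X]
    (f : X → EReal) : Prop where
  ne_bot : ∀ x, f x ≠ ⊥
  proper : (effDomain f).Nonempty
  lsc : LowerSemicontinuous f
  convex : Convex ℝ (epigraph f)

/-- The Fenchel conjugate `f*(x*) = sup_x (⟨x*, x⟩ - f x)`. -/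
noncomputable def fenchelConj {X : Type*} [NormedAddCommGroup X] [NormedSpace ℝ X]
    (f : X → EReal) (xs : StrongDual ℝ X) : EReal :=
  ⨆ x : X, (((xs x : ℝ) : EReal) - f x)

/-- `𝒮(Z)`: the closed separable linear subspaces of `Z`. -/
def closedSepSubspaces (Z : Type*) [NormedAddCommGroup Z] [NormedSpace ℝ Z] :
    Set (Submodule ℝ Z) :=
  {W | IsClosed (W : Set Z) ∧ TopologicalSpace.IsSeparable (W : Set Z)}

/-- The maximal rectangle-family in `𝒮(X₁ × X₂)`: all products `V × Y` with `V ∈ 𝒮(X₁)` and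
`Y ∈ 𝒮(X₂)`. -/
def closedSepRectangles (X₁ X₂ : Type*) [NormedAddCommGroup X₁] [NormedSpace ℝ X₁]
    [NormedAddCommGroup X₂] [NormedSpace ℝ X₂] : Set (Submodule ℝ (X₁ × X₂)) :=
  {W | ∃ V ∈ closedSepSubspaces X₁, ∃ Y ∈ closedSepSubspaces X₂, W = V.prod Y}

/-- A rich family in `𝒮(Z)`: cofinal, and closed under closures of increasing countable unions. -/
structure IsRichFamily {Z : Type*} [NormedAddCommGroup Z] [NormedSpace ℝ Z]
    (R : Set (Submodule ℝ Z)) : Prop where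
  subset : R ⊆ closedSepSubspaces Z
  cofinal : ∀ S ∈ closedSepSubspaces Z, ∃ W ∈ R, S ≤ W
  sigma_closed : ∀ W : ℕ → Submodule ℝ Z, Monotone W → (∀ n, W n ∈ R) →
    ∃ U ∈ R, (U : Set Z) = closure (⋃ n, (W n : Set Z))

/-- The closure in the weak-star topology of a subset of the dual space. -/
def weakStarClosure {X : Type*} [NormedAddCommGroup X] [NormedSpace ℝ X]
    (S : Set (StrongDual ℝ X)) : Set (StrongDual ℝ X) :=
  {xs | StrongDual.toWeakDual xs ∈ closure (StrongDual.toWeakDual '' S)}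

/-! Good rectangles satisfy `X = V + Y_⊥`: every `x` has some `v ∈ V` on which all of `Y`, hence its
weak* closure, takes the same values (`exists_mem_eqOn_of_representsOn`). Since `f` on `V` is the
supremum of its affine minorants with slope in `Y`, also `f v ≤ f x`
(`le_of_attainsSup_affineMinorants`). So the term of `f*` at `x` is at most the term at `v`; the
other inequality is trivial. Richness holds because each condition makes one factor answer countably
many demands of the other. Weak compactness of `A` carries `RepresentsOn` to limits, and the bound
on slopes carries `AttainsSup`. -/

open Filter Topology TopologicalSpace

/-! ### Rich families of rectangles -/

section RichFamilies

variable {Z Z' : Type*} [NormedAddCommGroup Z] [NormedSpace ℝ Z]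
  [NormedAddCommGroup Z'] [NormedSpace ℝ Z']

theorem coe_topologicalClosure_iSup_of_monotone {V : ℕ → Submodule ℝ Z} (hV : Monotone V) :
    ((⨆ n, V n).topologicalClosure : Set Z) = closure (⋃ n, (V n : Set Z)) := by
  rw [Submodule.topologicalClosure_coe, Submodule.coe_iSup_of_directed _ hV.directed_le]

theorem topologicalClosure_mem_closedSepSubspaces {V : Submodule ℝ Z}
    (hV : IsSeparable (V : Set Z)) : V.topologicalClosure ∈ closedSepSubspaces Z :=
  ⟨V.isClosed_topologicalClosure, by
    rw [Submodule.topologicalClosure_coe]; exact hV.closure⟩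

theorem topologicalClosure_iSup_mem_closedSepSubspaces {V : ℕ → Submodule ℝ Z}
    (hV : Monotone V) (h : ∀ n, V n ∈ closedSepSubspaces Z) :
    (⨆ n, V n).topologicalClosure ∈ closedSepSubspaces Z := by
  refine topologicalClosure_mem_closedSepSubspaces ?_
  rw [Submodule.coe_iSup_of_directed _ hV.directed_le]
  exact IsSeparable.iUnion fun n => (h n).2

/-- A closed separable subspace can be enlarged to contain a given countable set. -/
theorem exists_closedSepSubspace_ge {V : Submodule ℝ Z} (hV : V ∈ closedSepSubspaces Z)
    {s : Set Z} (hs : s.Countable) : ∃ V' ∈ closedSepSubspaces Z, V ≤ V' ∧ s ⊆ V' := by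
  refine ⟨(Submodule.span ℝ ((V : Set Z) ∪ s)).topologicalClosure,
    topologicalClosure_mem_closedSepSubspaces (hV.2.union hs.isSeparable).span, ?_, ?_⟩
  · exact fun x hx => Submodule.le_topologicalClosure _ (Submodule.subset_span (Or.inl hx))
  · exact fun x hx => Submodule.le_topologicalClosure _ (Submodule.subset_span (Or.inr hx))

theorem prod_le_prod_iff_of_submodule {V V' : Submodule ℝ Z} {Y Y' : Submodule ℝ Z'} :
    V.prod Y ≤ V'.prod Y' ↔ V ≤ V' ∧ Y ≤ Y' := by
  refine ⟨fun h => ⟨fun x hx => ?_, fun y hy => ?_⟩, fun h => Submodule.prod_mono h.1 h.2⟩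
  · exact (h (show (x, (0 : Z')) ∈ V.prod Y from ⟨hx, Y.zero_mem⟩)).1
  · exact (h (show ((0 : Z), y) ∈ V.prod Y from ⟨V.zero_mem, hy⟩)).2

theorem prod_mem_closedSepSubspaces {V : Submodule ℝ Z} {Y : Submodule ℝ Z'}
    (hV : V ∈ closedSepSubspaces Z) (hY : Y ∈ closedSepSubspaces Z') :
    V.prod Y ∈ closedSepSubspaces (Z × Z') :=
  ⟨by simpa using hV.1.prod hY.1, by simpa using hV.2.prod hY.2⟩

/-- The rectangles on which a transfer relation is reflexive form a rich family, provided the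
relation can be solved for its second argument, is monotone in it, and holds at limits of
sequences along which it holds at consecutive terms. -/
theorem isRichFamily_rectangles
    {H : Submodule ℝ Z → Submodule ℝ Z' → Submodule ℝ Z → Submodule ℝ Z' → Prop}
    (hstep : ∀ V ∈ closedSepSubspaces Z, ∀ Y ∈ closedSepSubspaces Z',
      ∃ V' ∈ closedSepSubspaces Z, ∃ Y' ∈ closedSepSubspaces Z', V ≤ V' ∧ Y ≤ Y' ∧ H V Y V' Y')
    (hmono : ∀ V Y V' Y', H V Y V Y → V ≤ V' → Y ≤ Y' → H V Y V' Y')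
    (hlim : ∀ (V : ℕ → Submodule ℝ Z) (Y : ℕ → Submodule ℝ Z'), Monotone V → Monotone Y →
      (∀ n, H (V n) (Y n) (V (n + 1)) (Y (n + 1))) →
      H (⨆ n, V n).topologicalClosure (⨆ n, Y n).topologicalClosure
        (⨆ n, V n).topologicalClosure (⨆ n, Y n).topologicalClosure) :
    IsRichFamily {W : Submodule ℝ (Z × Z') | ∃ V ∈ closedSepSubspaces Z,
      ∃ Y ∈ closedSepSubspaces Z', W = V.prod Y ∧ H V Y V Y} where
  subset := by
    rintro _ ⟨V, hV, Y, hY, rfl, -⟩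
    exact prod_mem_closedSepSubspaces hV hY
  cofinal := by
    intro S hS
    have hfst : (S.map (LinearMap.fst ℝ Z Z')).topologicalClosure ∈ closedSepSubspaces Z :=
      topologicalClosure_mem_closedSepSubspaces (by simpa using hS.2.image continuous_fst)
    have hsnd : (S.map (LinearMap.snd ℝ Z Z')).topologicalClosure ∈ closedSepSubspaces Z' :=
      topologicalClosure_mem_closedSepSubspaces (by simpa using hS.2.image continuous_snd)
    let T := {p : Submodule ℝ Z × Submodule ℝ Z' //
      p.1 ∈ closedSepSubspaces Z ∧ p.2 ∈ closedSepSubspaces Z'}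
    have hstep' : ∀ p : T, ∃ p' : T, p.1.1 ≤ p'.1.1 ∧ p.1.2 ≤ p'.1.2 ∧
        H p.1.1 p.1.2 p'.1.1 p'.1.2 := by
      rintro ⟨⟨V, Y⟩, hV, hY⟩
      obtain ⟨V', hV', Y', hY', h⟩ := hstep V hV Y hY
      exact ⟨⟨(V', Y'), hV', hY'⟩, h⟩
    choose next h1 h2 h3 using hstep'
    let u : ℕ → T := fun n => Nat.rec ⟨(_, _), hfst, hsnd⟩ (fun _ p => next p) n
    have hV : Monotone fun n => (u n).1.1 := monotone_nat_of_le_succ fun n => h1 (u n)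
    have hY : Monotone fun n => (u n).1.2 := monotone_nat_of_le_succ fun n => h2 (u n)
    refine ⟨_, ⟨_, topologicalClosure_iSup_mem_closedSepSubspaces hV fun n => (u n).2.1,
      _, topologicalClosure_iSup_mem_closedSepSubspaces hY fun n => (u n).2.2, rfl,
      hlim _ _ hV hY fun n => h3 (u n)⟩, fun x hx => ⟨?_, ?_⟩⟩
    · exact Submodule.le_topologicalClosure _ (le_iSup (fun n => (u n).1.1) 0
        (Submodule.le_topologicalClosure _ ⟨x, hx, rfl⟩))
    · exact Submodule.le_topologicalClosure _ (le_iSup (fun n => (u n).1.2) 0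
        (Submodule.le_topologicalClosure _ ⟨x, hx, rfl⟩))
  sigma_closed := by
    intro W hW hWR
    choose V hV Y hY hVY hH using hWR
    have hle : ∀ m n, m ≤ n → V m ≤ V n ∧ Y m ≤ Y n := fun m n hmn =>
      prod_le_prod_iff_of_submodule.1 (by simpa only [← hVY] using hW hmn)
    have hVm : Monotone V := fun m n h => (hle m n h).1
    have hYm : Monotone Y := fun m n h => (hle m n h).2
    refine ⟨_, ⟨_, topologicalClosure_iSup_mem_closedSepSubspaces hVm hV,
      _, topologicalClosure_iSup_mem_closedSepSubspaces hYm hY, rfl,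
      hlim _ _ hVm hYm fun n => hmono _ _ _ _ (hH n) (hVm n.le_succ) (hYm n.le_succ)⟩, ?_⟩
    rw [Submodule.prod_coe, coe_topologicalClosure_iSup_of_monotone hVm,
      coe_topologicalClosure_iSup_of_monotone hYm, ← closure_prod_eq,
      ← Set.iUnion_prod_of_monotone (fun m n h => hVm h) (fun m n h => hYm h)]
    simp only [hVY, Submodule.prod_coe]

end RichFamilies

/-! ### Transfer conditions between `V` and `Y` -/

section Transfer

variable {X : Type*} [NormedAddCommGroup X] [NormedSpace ℝ X]

/-- Every point of `A` agrees on `Y` with a point of `A ∩ V`. -/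
def RepresentsOn (A : Set X) (V : Submodule ℝ X) (Y : Submodule ℝ (StrongDual ℝ X)) : Prop :=
  ∀ a ∈ A, ∃ v ∈ A, v ∈ V ∧ ∀ y ∈ Y, y v = y a

/-- On `D`, the affine functions in `E` (a pair `(y, b)` standing for `y - b`) can be replaced,
on each ball of slopes, by those with slope in `Y` without lowering the supremum. -/
def AttainsSup (E : Set (StrongDual ℝ X × ℝ)) (D : Set X) (Y : Submodule ℝ (StrongDual ℝ X)) :
    Prop :=
  ∀ v ∈ D, ∀ (r : ℕ) (q : ℝ), ∀ p ∈ E, ‖p.1‖ ≤ r → q < p.1 v - p.2 →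
    ∃ p' ∈ E, p'.1 ∈ Y ∧ ‖p'.1‖ ≤ r ∧ q < p'.1 v - p'.2

theorem RepresentsOn.mono {A : Set X} {V V' : Submodule ℝ X} {Y : Submodule ℝ (StrongDual ℝ X)}
    (h : RepresentsOn A V Y) (hV : V ≤ V') : RepresentsOn A V' Y := fun a ha =>
  let ⟨v, hvA, hvV, hv⟩ := h a ha
  ⟨v, hvA, hV hvV, hv⟩

theorem AttainsSup.mono {E : Set (StrongDual ℝ X × ℝ)} {D : Set X}
    {Y Y' : Submodule ℝ (StrongDual ℝ X)} (h : AttainsSup E D Y) (hY : Y ≤ Y') :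
    AttainsSup E D Y' := fun v hv r q p hp hpr hq =>
  let ⟨p', hp', hpY, h'⟩ := h v hv r q p hp hpr hq
  ⟨p', hp', hY hpY, h'⟩

/-- Affine functions with slope of norm at most `r` are `r`-Lipschitz, so a strict inequality
survives a small move of the point. -/
theorem AttainsSup.closure {E : Set (StrongDual ℝ X × ℝ)} {D : Set X}
    {Y : Submodule ℝ (StrongDual ℝ X)} (h : AttainsSup E D Y) : AttainsSup E (closure D) Y := by
  intro v hv r q p hp hpr hq
  -- A third of the gap pays for moving to `d`, another for moving back; `r + 1` covers `r = 0`.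
  obtain ⟨d, hd, hvd⟩ := Metric.mem_closure_iff.1 hv ((p.1 v - p.2 - q) / (3 * (r + 1)))
    (div_pos (by linarith) (by positivity))
  have hr : (r : ℝ) * ‖v - d‖ ≤ (p.1 v - p.2 - q) / 3 := by
    rw [dist_eq_norm, lt_div_iff₀ (by positivity)] at hvd
    nlinarith [norm_nonneg (v - d)]
  have key : ∀ y : StrongDual ℝ X, ‖y‖ ≤ r → |y v - y d| ≤ (p.1 v - p.2 - q) / 3 := fun y hy => by
    rw [← map_sub]
    exact ((y.le_of_opNorm_le hy _).trans hr)
  obtain ⟨p', hp', hpY, hpr', hq'⟩ := h d hd r (q + (p.1 v - p.2 - q) / 3) p hp hpr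
    (by linarith [(abs_le.1 (key _ hpr)).2])
  exact ⟨p', hp', hpY, hpr', by linarith [(abs_le.1 (key _ hpr')).1]⟩

theorem exists_attainsSup (E : Set (StrongDual ℝ X × ℝ)) {V : Submodule ℝ X}
    (hV : IsSeparable (V : Set X)) {Y : Submodule ℝ (StrongDual ℝ X)}
    (hY : Y ∈ closedSepSubspaces (StrongDual ℝ X)) :
    ∃ Y' ∈ closedSepSubspaces (StrongDual ℝ X), Y ≤ Y' ∧ AttainsSup E V Y' := by
  obtain ⟨D, hD, hVD⟩ := hV
  have hch : ∀ i : D × ℕ × ℚ, ∃ p' : StrongDual ℝ X × ℝ,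
      (∃ p ∈ E, ‖p.1‖ ≤ i.2.1 ∧ (i.2.2 : ℝ) < p.1 i.1 - p.2) →
        p' ∈ E ∧ ‖p'.1‖ ≤ i.2.1 ∧ (i.2.2 : ℝ) < p'.1 i.1 - p'.2 := by
    intro i
    by_cases h : ∃ p ∈ E, ‖p.1‖ ≤ i.2.1 ∧ (i.2.2 : ℝ) < p.1 i.1 - p.2
    · exact h.imp fun p hp _ => hp
    -- This default need not lie in `E`; it only adds the slope `0` to `Y'`.
    · exact ⟨0, fun h' => absurd h' h⟩
  choose c hc using hch
  have := hD.to_subtype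
  obtain ⟨Y', hY', hYY', hcY⟩ := exists_closedSepSubspace_ge hY
    (Set.countable_range fun i => (c i).1)
  refine ⟨Y', hY', hYY', ?_⟩
  suffices h : AttainsSup E D Y' from fun v hv => h.closure v (hVD hv)
  intro d hd r q p hp hpr hq
  obtain ⟨s, hqs, hs⟩ := exists_rat_btwn hq
  obtain ⟨h1, h2, h3⟩ := hc (⟨d, hd⟩, r, s) ⟨p, hp, hpr, hs⟩
  exact ⟨_, h1, hcY ⟨_, rfl⟩, h2, hqs.trans h3⟩

theorem AttainsSup.limit {E : Set (StrongDual ℝ X × ℝ)} {V : ℕ → Submodule ℝ X}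
    {Y : ℕ → Submodule ℝ (StrongDual ℝ X)} (hV : Monotone V)
    (h : ∀ n, AttainsSup E (V n) (Y (n + 1))) :
    AttainsSup E (⨆ n, V n).topologicalClosure (⨆ n, Y n).topologicalClosure := by
  rw [coe_topologicalClosure_iSup_of_monotone hV]
  refine AttainsSup.closure fun v hv => ?_
  obtain ⟨n, hn⟩ := Set.mem_iUnion.1 hv
  exact (h n).mono ((le_iSup Y (n + 1)).trans (Submodule.le_topologicalClosure _)) v hn

theorem continuous_dual_weakSpace (y : StrongDual ℝ X) :
    Continuous fun w : WeakSpace ℝ X => y ((toWeakSpace ℝ X).symm w) :=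
  WeakBilin.eval_continuous (topDualPairing ℝ X).flip y

/-- Mazur: norm and weak closures of convex sets agree. -/
theorem Submodule.isClosed_weakSpace {V : Submodule ℝ X} (hV : IsClosed (V : Set X)) :
    IsClosed (toWeakSpace ℝ X '' (V : Set X)) := by
  rw [← closure_eq_iff_isClosed, ← V.convex.toWeakSpace_closure ℝ, hV.closure_eq]

/-- The point `v` is a weak cluster point of `l`; each `y v` clusters along a convergent filter, so
it equals the limit. -/
theorem exists_mem_eqOn_of_tendsto {A : Set X} (hA : IsCompact (toWeakSpace ℝ X '' A))
    {V : Submodule ℝ X} (hV : IsClosed (V : Set X)) {Y : Set (StrongDual ℝ X)} {a : X}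
    {l : Filter X} [l.NeBot] (hlA : ∀ᶠ x in l, x ∈ A) (hlV : ∀ᶠ x in l, x ∈ V)
    (h : ∀ y ∈ Y, Tendsto y l (𝓝 (y a))) : ∃ v ∈ A, v ∈ V ∧ ∀ y ∈ Y, y v = y a := by
  obtain ⟨_, ⟨v, hvA, rfl⟩, hv⟩ := hA (f := map (toWeakSpace ℝ X) l)
    (le_principal_iff.2 (hlA.mono fun x hx => ⟨x, hx, rfl⟩))
  refine ⟨v, hvA, ?_, fun y hy => ?_⟩
  · obtain ⟨v', hv', he⟩ := isClosed_iff_clusterPt.1 (Submodule.isClosed_weakSpace hV) _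
      (hv.mono (le_principal_iff.2 (hlV.mono fun x hx => ⟨x, hx, rfl⟩)))
    rwa [← (toWeakSpace ℝ X).injective he]
  · have hc : MapClusterPt (y v) l y :=
      MapClusterPt.continuousAt_comp (F := l) (u := toWeakSpace ℝ X)
        (f := fun w => y ((toWeakSpace ℝ X).symm w)) (continuous_dual_weakSpace y).continuousAt hv
    exact eq_of_nhds_neBot (ClusterPt.mono hc (h y hy))

/-- Restricting to a countable `D` dense in `Y` maps `A` into the separable metrizable space `ℝ^D`;
lifting a countable dense subset of the image gives the points to add to `V`. -/
theorem exists_representsOn {A : Set X} (hA : IsCompact (toWeakSpace ℝ X '' A))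
    {V : Submodule ℝ X} (hV : V ∈ closedSepSubspaces X) {Y : Submodule ℝ (StrongDual ℝ X)}
    (hY : IsSeparable (Y : Set (StrongDual ℝ X))) :
    ∃ V' ∈ closedSepSubspaces X, V ≤ V' ∧ RepresentsOn A V' Y := by
  obtain ⟨D, hD, hYD⟩ := hY
  have := hD.to_subtype
  let φ : X → D → ℝ := fun x d => d.1 x
  obtain ⟨t, htA, ht, hAt⟩ := (IsSeparable.of_separableSpace (φ '' A)).exists_countable_dense_subset
  obtain ⟨s, hsA, rfl⟩ := Set.subset_image_iff.1 htA
  -- `s` may be uncountable; `B` keeps one preimage per image point.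
  obtain ⟨B, hBs, hBφ⟩ := Set.exists_subset_bijOn s φ
  have hBA : B ⊆ A := hBs.trans hsA
  rw [← hBφ.image_eq] at ht hAt
  have hB : B.Countable := Set.countable_of_injective_of_countable_image hBφ.injOn ht
  obtain ⟨V', hV', hVV', hBV⟩ := exists_closedSepSubspace_ge hV hB
  refine ⟨V', hV', hVV', fun a ha => ?_⟩
  have hcl : φ a ∈ closure (φ '' B) := hAt ⟨a, ha, rfl⟩
  have : (comap φ (𝓝 (φ a)) ⊓ 𝓟 B).NeBot := by
    rw [← map_neBot_iff φ, Filter.push_pull', map_principal]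
    exact mem_closure_iff_clusterPt.1 hcl
  obtain ⟨v, hvA, hvV, hv⟩ := exists_mem_eqOn_of_tendsto hA hV'.1 (Y := D) (a := a)
    (l := comap φ (𝓝 (φ a)) ⊓ 𝓟 B)
    (mem_inf_of_right hBA) (mem_inf_of_right hBV) fun y hy =>
      ((continuous_apply (⟨y, hy⟩ : D)).tendsto (φ a)).comp (tendsto_comap.mono_left inf_le_left)
  refine ⟨v, hvA, hvV, fun y hy => ?_⟩
  exact closure_minimal (t := {y : StrongDual ℝ X | y v = y a}) hv
    (isClosed_eq (by fun_prop) (by fun_prop)) (hYD hy)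

/-- Representatives of `a` on `Y n` are eventually exact at each `y` of the union, so a weak cluster
point serves. -/
theorem RepresentsOn.limit {A : Set X} (hA : IsCompact (toWeakSpace ℝ X '' A))
    {V : ℕ → Submodule ℝ X} {Y : ℕ → Submodule ℝ (StrongDual ℝ X)} (hY : Monotone Y)
    (h : ∀ n, RepresentsOn A (V (n + 1)) (Y n)) :
    RepresentsOn A (⨆ n, V n).topologicalClosure (⨆ n, Y n).topologicalClosure := by
  intro a ha
  choose v hvA hvV hv using fun n => h n a ha
  obtain ⟨w, hwA, hwV, hw⟩ := exists_mem_eqOn_of_tendsto hA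
    (⨆ n, V n).isClosed_topologicalClosure (Y := ⋃ n, (Y n : Set (StrongDual ℝ X))) (a := a)
    (l := map v atTop) (eventually_map.2 (Eventually.of_forall hvA))
    (eventually_map.2 (Eventually.of_forall fun n =>
      Submodule.le_topologicalClosure _ (le_iSup V (n + 1) (hvV n)))) (by
      intro y hy
      obtain ⟨m, hm⟩ := Set.mem_iUnion.1 hy
      rw [tendsto_map'_iff]
      refine tendsto_const_nhds.congr' ?_
      filter_upwards [eventually_ge_atTop m] with n hn
      exact (hv n y (hY hn hm)).symm)
  refine ⟨w, hwA, hwV, fun y hy => ?_⟩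
  rw [← SetLike.mem_coe, coe_topologicalClosure_iSup_of_monotone hY] at hy
  exact closure_minimal (t := {y : StrongDual ℝ X | y w = y a}) hw
    (isClosed_eq (by fun_prop) (by fun_prop)) hy

/-- The family of pairs on which points of `A` are represented and suprema of the families `E`, `F`
of affine functions are attained is rich. -/
theorem isRichFamily_representsOn_attainsSup {A : Set X}
    (hA : IsCompact (toWeakSpace ℝ X '' A)) (E F : Set (StrongDual ℝ X × ℝ)) :
    IsRichFamily {W : Submodule ℝ (X × StrongDual ℝ X) | ∃ V ∈ closedSepSubspaces X,
      ∃ Y ∈ closedSepSubspaces (StrongDual ℝ X), W = V.prod Y ∧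
        (RepresentsOn A V Y ∧ AttainsSup E V Y ∧ AttainsSup F V Y)} := by
  refine isRichFamily_rectangles
    -- Old `Y` constrains only new `V'`, and old `V` only new `Y'`, so one step needs no fixed
    -- point.
    (H := fun V Y V' Y' => RepresentsOn A V' Y ∧ AttainsSup E V Y' ∧ AttainsSup F V Y') ?_ ?_ ?_
  · intro V hV Y hY
    obtain ⟨V', hV', hVV', hr⟩ := exists_representsOn hA hV hY.2
    obtain ⟨Y₁, hY₁, hYY₁, h₁⟩ := exists_attainsSup E hV.2 hY
    obtain ⟨Y₂, hY₂, hYY₂, h₂⟩ := exists_attainsSup F hV.2 hY₁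
    exact ⟨V', hV', Y₂, hY₂, hVV', hYY₁.trans hYY₂, hr, h₁.mono hYY₂, h₂⟩
  · exact fun V Y V' Y' h hV hY => ⟨h.1.mono hV, h.2.1.mono hY, h.2.2.mono hY⟩
  · exact fun V Y hV hY h => ⟨.limit hA hY fun n => (h n).1, .limit hV fun n => (h n).2.1,
      .limit hV fun n => (h n).2.2⟩

/-- If `A` is linearly dense and `Y` is `1`-norming for the closed subspace `V`, then `X` is the
sum of `V` and the annihilator of `Y`. -/
theorem exists_mem_eqOn_of_representsOn [CompleteSpace X] {A : Set X}
    (hA : Dense (Submodule.span ℝ A : Set X)) {V : Submodule ℝ X} (hV : IsClosed (V : Set X))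
    {Y : Submodule ℝ (StrongDual ℝ X)} (hr : RepresentsOn A V Y)
    (hn : AttainsSup {p | p.2 = 0} (V : Set X) Y) (x : X) : ∃ v ∈ V, ∀ y ∈ Y, y v = y x := by
  have hspan : ∀ x ∈ Submodule.span ℝ A, ∃ v ∈ V, ∀ y ∈ Y, y v = y x := by
    intro x hx
    induction hx using Submodule.span_induction with
    | mem x hx => obtain ⟨v, -, hv⟩ := hr x hx; exact ⟨v, hv⟩
    | zero => exact ⟨0, V.zero_mem, fun _ _ => rfl⟩
    | add x y _ _ hx hy =>
      obtain ⟨v, hv, hvx⟩ := hx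
      obtain ⟨w, hw, hwy⟩ := hy
      exact ⟨v + w, V.add_mem hv hw, fun z hz => by rw [map_add, map_add, hvx z hz, hwy z hz]⟩
    | smul c x _ hx =>
      obtain ⟨v, hv, hvx⟩ := hx
      exact ⟨c • v, V.smul_mem c hv, fun z hz => by rw [map_smul, map_smul, hvx z hz]⟩
  -- The assignment `z ↦ v` is contractive, so representatives of a convergent sequence are Cauchy.
  have hnorm : ∀ v ∈ V, ∀ z : X, (∀ y ∈ Y, y v = y z) → ‖v‖ ≤ ‖z‖ := by
    intro v hv z hz
    obtain ⟨g, hg, hgv⟩ := exists_dual_vector'' ℝ v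
    refine le_of_forall_lt fun q hq => ?_
    obtain ⟨p, hp0, hpY, hp1, hqp⟩ := hn v hv 1 q (g, 0) rfl (by simpa using hg)
      (by simpa [hgv] using hq)
    rw [show p.2 = 0 from hp0, sub_zero, hz _ hpY] at hqp
    calc q < p.1 z := hqp
      _ ≤ ‖p.1 z‖ := le_abs_self _
      _ ≤ 1 * ‖z‖ := p.1.le_of_opNorm_le (by simpa using hp1) z
      _ = ‖z‖ := one_mul _
  obtain ⟨u, hu, hux⟩ := mem_closure_iff_seq_limit.1 (hA x)
  choose v hvV hv using fun n => hspan (u n) (hu n)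
  have hcau : CauchySeq v := by
    refine Metric.cauchySeq_iff.2 fun ε hε => ?_
    obtain ⟨N, hN⟩ := Metric.cauchySeq_iff.1 hux.cauchySeq ε hε
    refine ⟨N, fun m hm n hn => lt_of_le_of_lt ?_ (hN m hm n hn)⟩
    rw [dist_eq_norm, dist_eq_norm]
    exact hnorm _ (V.sub_mem (hvV m) (hvV n)) _ fun y hy => by
      rw [map_sub, map_sub, hv m y hy, hv n y hy]
  obtain ⟨w, hw⟩ := cauchySeq_tendsto_of_complete hcau
  refine ⟨w, hV.mem_of_tendsto hw (Eventually.of_forall hvV), fun y hy => ?_⟩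
  have h1 := (y.continuous.tendsto w).comp hw
  have h2 := (y.continuous.tendsto x).comp hux
  refine tendsto_nhds_unique h1 (h2.congr fun n => (hv n y hy).symm)

theorem eq_of_mem_weakStarClosure {S : Set (StrongDual ℝ X)} {u v : X}
    (h : ∀ y ∈ S, y u = y v) {xs : StrongDual ℝ X} (hxs : xs ∈ weakStarClosure S) :
    xs u = xs v := by
  refine closure_minimal (t := {w : WeakDual ℝ X | w u = w v}) ?_
    (isClosed_eq (WeakDual.eval_continuous u) (WeakDual.eval_continuous v)) hxs
  rintro _ ⟨y, hy, rfl⟩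
  exact h y hy

end Transfer

/-! ### Affine minorants of `f` -/

section AffineMinorants

variable {X : Type*} [NormedAddCommGroup X] [NormedSpace ℝ X]

/-- The pairs `(y, b)` such that `y - b ≤ f`. -/
def affineMinorants (f : X → EReal) : Set (StrongDual ℝ X × ℝ) :=
  {p | ∀ x, ((p.1 x - p.2 : ℝ) : EReal) ≤ f x}

theorem isClosed_epigraph {X : Type*} [TopologicalSpace X] {f : X → EReal} (hf : LowerSemicontinuous f) :
    IsClosed (epigraph f) :=
  hf.isClosed_epigraph.preimage (continuous_id.prodMap continuous_coe_real_ereal)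

theorem exists_separating_pair {f : X → EReal} (hf : IsProperLscConvex f) {v : X} {c : ℝ}
    (hc : (c : EReal) < f v) : ∃ (y : StrongDual ℝ X) (α b : ℝ), y v + α * c < b ∧
      ∀ x t, f x ≤ (t : ℝ) → b < y x + α * t := by
  obtain ⟨L, b, hL, hb⟩ := geometric_hahn_banach_point_closed hf.convex
    (isClosed_epigraph hf.lsc) (x := (v, c)) (not_le.2 hc)
  have hLe : ∀ x t, L (x, t) = L.comp (.inl ℝ X ℝ) x + L (0, 1) * t := by
    intro x t
    have : L (0, t) = L (0, 1) * t := by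
      rw [mul_comm, ← smul_eq_mul, ← map_smul]; simp
    rw [← this, ContinuousLinearMap.comp_apply, ContinuousLinearMap.inl_apply, ← map_add]
    simp
  exact ⟨L.comp (.inl ℝ X ℝ), L (0, 1), b, by rwa [← hLe], fun x t h => by
    rw [← hLe]; exact hb _ h⟩

theorem mem_affineMinorants_of_pos {f : X → EReal} (hf : ∀ x, f x ≠ ⊥) {y : StrongDual ℝ X}
    {α b : ℝ} (hα : 0 < α) (h : ∀ x t, f x ≤ (t : ℝ) → b < y x + α * t) :
    (-(α⁻¹ • y), -(b / α)) ∈ affineMinorants f := by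
  intro x
  induction hx : f x with
  | bot => exact absurd hx (hf x)
  | top => exact le_top
  | coe t =>
    have := h x t hx.le
    refine EReal.coe_le_coe_iff.2 ?_
    simp only [neg_apply, smul_apply, smul_eq_mul]
    rw [← sub_nonneg, show t - (-(α⁻¹ * y x) - -(b / α)) = (y x + α * t - b) / α by
      field_simp; ring]
    exact div_nonneg (by linarith) hα.le

/-- A proper lower semicontinuous convex function is the supremum of its continuous affine
minorants. -/
theorem exists_affineMinorant_gt {f : X → EReal} (hf : IsProperLscConvex f) {v : X} {c : ℝ}
    (hc : (c : EReal) < f v) : ∃ p ∈ affineMinorants f, c < p.1 v - p.2 := by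
  obtain ⟨x₀, hx₀⟩ := hf.proper
  obtain ⟨t₀, ht₀⟩ : ∃ t : ℝ, f x₀ = t := ⟨(f x₀).toReal,
    (EReal.coe_toReal hx₀.ne (hf.ne_bot x₀)).symm⟩
  -- Separating a point strictly below the graph over the domain forces `α > 0`.
  obtain ⟨p₀, hp₀⟩ : (affineMinorants f).Nonempty := by
    obtain ⟨y, α, b, h1, h2⟩ := exists_separating_pair hf (v := x₀) (c := t₀ - 1)
      (by rw [ht₀]; exact EReal.coe_lt_coe_iff.2 (by linarith))
    exact ⟨_, mem_affineMinorants_of_pos hf.ne_bot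
      (by nlinarith [h2 x₀ t₀ ht₀.le]) h2⟩
  obtain ⟨y, α, b, h1, h2⟩ := exists_separating_pair hf hc
  -- The epigraph is unbounded upwards over `x₀`.
  have hα : 0 ≤ α := by
    by_contra! hα
    obtain ⟨n, hn⟩ := exists_nat_gt ((y x₀ + α * t₀ - b) / -α)
    have := h2 x₀ (t₀ + n) (by rw [ht₀]; exact EReal.coe_le_coe_iff.2 (by simp))
    rw [div_lt_iff₀ (by linarith)] at hn
    nlinarith
  rcases hα.eq_or_lt with rfl | hα
  -- Vertical hyperplane: `b - y` is negative on the domain and positive at `v`, so a large multiple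
  -- of it is added to `p₀`.
  · have hδ : 0 < b - y v := by linarith
    obtain ⟨n, hn⟩ := exists_nat_gt ((c - (p₀.1 v - p₀.2)) / (b - y v))
    rw [div_lt_iff₀ hδ] at hn
    refine ⟨(p₀.1 - (n : ℝ) • y, p₀.2 - n * b), fun x => ?_, ?_⟩
    · induction hx : f x with
      | bot => exact absurd hx (hf.ne_bot x)
      | top => exact le_top
      | coe t =>
        have h3 := h2 x t hx.le
        have h4 := hp₀ x
        rw [hx, EReal.coe_le_coe_iff] at h4
        refine EReal.coe_le_coe_iff.2 ?_
        simp only [sub_apply, smul_apply, smul_eq_mul]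
        nlinarith [(n.cast_nonneg : (0 : ℝ) ≤ n)]
    · simp only [sub_apply, smul_apply, smul_eq_mul]
      linarith
  · refine ⟨_, mem_affineMinorants_of_pos hf.ne_bot hα h2, ?_⟩
    simp only [neg_apply, smul_apply, smul_eq_mul]
    rw [← sub_pos, show -(α⁻¹ * y v) - -(b / α) - c = (b - (y v + α * c)) / α by
      field_simp; ring]
    exact div_pos (by linarith) hα

theorem le_of_attainsSup_affineMinorants {f : X → EReal} (hf : IsProperLscConvex f) {D : Set X}
    {Y : Submodule ℝ (StrongDual ℝ X)} (hn : AttainsSup (affineMinorants f) D Y) {v x : X}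
    (hv : v ∈ D) (h : ∀ y ∈ Y, y v = y x) : f v ≤ f x := by
  by_contra! hlt
  obtain ⟨c, hxc, hcv⟩ := EReal.lt_iff_exists_real_btwn.1 hlt
  obtain ⟨p, hp, hcp⟩ := exists_affineMinorant_gt hf hcv
  obtain ⟨r, hr⟩ := exists_nat_ge ‖p.1‖
  obtain ⟨p', hp', hpY, -, hq⟩ := hn v hv r c p hp hr hcp
  rw [h _ hpY] at hq
  exact absurd ((hp' x).trans_lt hxc) (not_lt.2 (EReal.coe_le_coe_iff.2 hq.le))

end AffineMinorants

/-! ### The main theorem -/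

theorem mainTheorem7 {X : Type*} [NormedAddCommGroup X] [NormedSpace ℝ X] [CompleteSpace X]
    (hX : IsWCG X) (f : X → EReal) (hf : IsProperLscConvex f) :
    ∃ R : Set (Submodule ℝ (X × StrongDual ℝ X)),
      R ⊆ closedSepRectangles X (StrongDual ℝ X) ∧ IsRichFamily R ∧
      ∀ (V : Submodule ℝ X) (Y : Submodule ℝ (StrongDual ℝ X)), V.prod Y ∈ R →
        ∀ xs ∈ weakStarClosure (Y : Set (StrongDual ℝ X)),
          fenchelConj (fun v : V => f (v : X)) (xs.comp V.subtypeL) = fenchelConj f xs := by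
  obtain ⟨A, hA, hspan⟩ := hX
  -- Pairs with `p.2 = 0` are the linear functionals and make `Y` norming on `V`; the affine
  -- minorants control `f`.
  refine ⟨_, ?_, isRichFamily_representsOn_attainsSup hA {p | p.2 = 0} (affineMinorants f), ?_⟩
  · rintro _ ⟨V, hV, Y, hY, rfl, -⟩
    exact ⟨V, hV, Y, hY, rfl⟩
  · rintro V Y ⟨V', hV', Y', -, heq, hr, hn, hm⟩ xs hxs
    obtain ⟨hV₁, hY₁⟩ := prod_le_prod_iff_of_submodule.1 heq.le
    obtain ⟨hV₂, hY₂⟩ := prod_le_prod_iff_of_submodule.1 heq.ge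
    obtain rfl := le_antisymm hV₁ hV₂
    obtain rfl := le_antisymm hY₁ hY₂
    refine le_antisymm (iSup_le fun v => ?_) (iSup_le fun x => ?_)
    · exact le_iSup (fun x : X => ((xs x : ℝ) : EReal) - f x) v
    · obtain ⟨v, hv, hvx⟩ := exists_mem_eqOn_of_representsOn hspan hV'.1 hr hn x
      refine le_trans ?_ (le_iSup (fun v : V => (((xs.comp V.subtypeL) v : ℝ) : EReal) - f v)
        ⟨v, hv⟩)
      have h1 := le_of_attainsSup_affineMinorants hf hm hv hvx
      have h2 : xs v = xs x := eq_of_mem_weakStarClosure hvx hxs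
      simp only [ContinuousLinearMap.comp_apply, Submodule.subtypeL_apply, h2]
      exact EReal.sub_le_sub le_rfl h1
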